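/- Let $H$ be a complex Hilbert space of dimension at least $2$ and let $T$ be a bounded linear operator on $H$. Let $m(T)=\inf\{\|Tx\| : \|x\|=1\}$ be the minimum modulus of $T$, and let $\hat\varepsilon(T)$ be the infimum of all $\varepsilon\in[0,1]$ such that, for all $x,y\in H$, $\langle x,y\rangle=0$ implies $|\langle Tx,Ty\rangle|\le\varepsilon\,\|Tx\|\,\|Ty\|$. Let $\mathbb{C}\mathcal{V}$ be the set of all scalar multiples $\lambda V$, where $\lambda\in\mathbb{C}$ and $V$ is a (not necessarily surjective) linear isometry of $H$ into itself, and let $\mathrm{dist}(T,\mathbb{C}\mathcal{V})=\inf\{\|T-S\| : S\in\mathbb{C}\mathcal{V}\}$ in the operator norm. If $\dim\ker T\le\dim\ker T^{*}$, where $\dim$ denotes the Hilbert space dimension (the cardinality of an orthonormal basis), then $$\mathrm{dist}(T,\mathbb{C}\mathcal{V})=\frac{\|T\|-m(T)}{2}=\frac{1-\sqrt{\frac{1-\hat\varepsilon(T)}{1+\hat\varepsilon(T)}}}{2}\,\|T\|.$$ -/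

import Mathlib

noncomputable section

/-- Hilbert-space dimension: the cardinality of a Hilbert (complete orthonormal) basis. All Hilbert
bases of a Hilbert space are equipotent, so the infimum below is their common cardinality. This is
not the algebraic dimension `Module.rank`, which is different in infinite dimension. -/
def hilbertDim.{u} (E : Type u) [NormedAddCommGroup E] [InnerProductSpace ℂ E] : Cardinal.{u} :=
  sInf {c : Cardinal.{u} | ∃ ι : Type u, Nonempty (HilbertBasis ι ℂ E) ∧ Cardinal.mk ι = c}

section Operators

variable {H : Type*} [NormedAddCommGroup H] [InnerProductSpace ℂ H]

/-- The minimum modulus `m(T) = inf {‖T x‖ : ‖x‖ = 1}`. -/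
def minModulus (T : H →L[ℂ] H) : ℝ :=
  sInf {r : ℝ | ∃ x : H, ‖x‖ = 1 ∧ ‖T x‖ = r}

/-- Two vectors are `ε`-orthogonal if `|⟨x, y⟩| ≤ ε ‖x‖ ‖y‖`. -/
def EpsOrthogonal (ε : ℝ) (x y : H) : Prop :=
  ‖inner ℂ x y‖ ≤ ε * ‖x‖ * ‖y‖

/-- `T` is `ε`-approximately orthogonality preserving. (For `ε = 1` this holds for every `T`, by
the Cauchy-Schwarz inequality.) -/
def IsAOP (ε : ℝ) (T : H →L[ℂ] H) : Prop :=
  ∀ x y : H, inner ℂ x y = 0 → EpsOrthogonal ε (T x) (T y)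

/-- The infimum of all `ε ∈ [0, 1]` for which `T` is `ε`-approximately orthogonality preserving. -/
def epsHat (T : H →L[ℂ] H) : ℝ :=
  sInf {ε : ℝ | ε ∈ Set.Icc (0 : ℝ) 1 ∧ IsAOP ε T}

/-- The set of all scalar multiples of (not necessarily surjective) linear isometries of `H`. -/
def scalarIsometries (H : Type*) [NormedAddCommGroup H] [InnerProductSpace ℂ H] :
    Set (H →L[ℂ] H) :=
  {S | ∃ (c : ℂ) (V : H →L[ℂ] H), Isometry V ∧ S = c • V}

end Operators

end

/-! Write `M = ‖T‖`, `m = m(T)`. If `‖T - cV‖ = d`, then `M ≤ d + |c|` and `|c| - d ≤ m`, so `d ≥ (M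
- m)/2`. This is attained through the polar decomposition `T = V|T|`: the kernel condition lets the
partial isometry extend to an isometry `V` of `H`, and `|T|` has spectrum in `[m, M]`, hence lies
within `(M - m)/2` of the scalar `(M + m)/2`. The second formula amounts to `epsHat T = (M² -
m²)/(M² + m²)`: Wielandt's inequality gives `≤`, and norm distortion of approximately orthogonality
preserving maps gives `≥`. -/

/-- A Hilbert space of smaller Hilbert dimension embeds isometrically. -/
theorem exists_linearIsometry_of_hilbertDim_le.{u} {E F : Type u} [NormedAddCommGroup E]
    [InnerProductSpace ℂ E] [CompleteSpace E] [NormedAddCommGroup F] [InnerProductSpace ℂ F]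
    [CompleteSpace F] (h : hilbertDim E ≤ hilbertDim F) : Nonempty (E →ₗᵢ[ℂ] F) := by
  have key : ∀ (G : Type u) [NormedAddCommGroup G] [InnerProductSpace ℂ G] [CompleteSpace G],
      ∃ ι : Type u, Nonempty (HilbertBasis ι ℂ G) ∧ Cardinal.mk ι = hilbertDim G := by
    intro G _ _ _
    obtain ⟨w, b, -⟩ := exists_hilbertBasis ℂ G
    -- Cardinals are well-ordered, so the infimum is attained by some basis; equipotence of bases is
    -- not needed.
    exact csInf_mem
      (s := {c : Cardinal.{u} | ∃ ι : Type u, Nonempty (HilbertBasis ι ℂ G) ∧ Cardinal.mk ι = c})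
      ⟨_, w, ⟨b⟩, rfl⟩
  obtain ⟨ι, ⟨b⟩, hι⟩ := key E
  obtain ⟨κ, ⟨c⟩, hκ⟩ := key F
  rw [← hι, ← hκ] at h
  obtain ⟨f⟩ := Cardinal.le_def _ _ |>.1 h
  have hv : Orthonormal ℂ (c ∘ f) := c.orthonormal.comp f f.injective
  exact ⟨hv.orthogonalFamily.linearIsometry.comp b.repr.toLinearIsometry⟩

section Operators

variable {H : Type*} [NormedAddCommGroup H] [InnerProductSpace ℂ H]

theorem minModulus_nonneg (T : H →L[ℂ] H) : 0 ≤ minModulus T :=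
  Real.sInf_nonneg (by rintro _ ⟨x, -, rfl⟩; exact norm_nonneg _)

theorem minModulus_le_norm_apply (T : H →L[ℂ] H) {x : H} (hx : ‖x‖ = 1) :
    minModulus T ≤ ‖T x‖ :=
  csInf_le ⟨0, by rintro _ ⟨x, -, rfl⟩; exact norm_nonneg _⟩ ⟨x, hx, rfl⟩

theorem minModulus_mul_norm_le (T : H →L[ℂ] H) (x : H) : minModulus T * ‖x‖ ≤ ‖T x‖ := by
  rcases eq_or_ne x 0 with rfl | hx
  · simp
  have h0 : 0 < ‖x‖ := norm_pos_iff.2 hx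
  have h := minModulus_le_norm_apply T (x := ((‖x‖⁻¹ : ℝ) : ℂ) • x)
    (by rw [norm_smul]; simp [h0.ne'])
  rw [map_smul, norm_smul] at h
  simp only [Complex.norm_real, norm_inv, norm_norm] at h
  rwa [← div_eq_inv_mul, le_div_iff₀ h0] at h

theorem le_minModulus [Nontrivial H] {T : H →L[ℂ] H} {r : ℝ}
    (h : ∀ x : H, ‖x‖ = 1 → r ≤ ‖T x‖) : r ≤ minModulus T := by
  obtain ⟨x, hx⟩ := exists_norm_eq H zero_le_one
  exact le_csInf ⟨_, x, hx, rfl⟩ (by rintro _ ⟨y, hy, rfl⟩; exact h y hy)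

theorem minModulus_le_norm [Nontrivial H] (T : H →L[ℂ] H) : minModulus T ≤ ‖T‖ := by
  obtain ⟨x, hx⟩ := exists_norm_eq H zero_le_one
  exact (minModulus_le_norm_apply T hx).trans (T.unit_le_opNorm x hx.le)

/-- An operator is at least `(‖T‖ - m(T)) / 2` away from each multiple of an isometry. -/
theorem norm_sub_smul_isometry_ge [Nontrivial H] (T V : H →L[ℂ] H) (hV : Isometry V) (c : ℂ) :
    (‖T‖ - minModulus T) / 2 ≤ ‖T - c • V‖ := by
  have hVx (x : H) : ‖V x‖ = ‖x‖ := by simpa using hV.dist_eq x 0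
  have h1 : ‖T‖ ≤ ‖T - c • V‖ + ‖c‖ := by
    have hV1 : ‖V‖ ≤ 1 := V.opNorm_le_bound zero_le_one (by simp [hVx])
    calc ‖T‖ = ‖(T - c • V) + c • V‖ := by simp
      _ ≤ ‖T - c • V‖ + ‖c • V‖ := norm_add_le _ _
      _ ≤ ‖T - c • V‖ + ‖c‖ := by
        rw [norm_smul]; gcongr; exact mul_le_of_le_one_right (norm_nonneg _) hV1
  have h2 : ‖c‖ - ‖T - c • V‖ ≤ minModulus T := by
    refine le_minModulus fun x hx => ?_
    have h3 : ‖(T - c • V) x‖ ≤ ‖T - c • V‖ := (T - c • V).unit_le_opNorm x hx.le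
    have h4 : ‖c • V x‖ ≤ ‖T x‖ + ‖T x - c • V x‖ := by
      simpa [norm_sub_rev] using norm_sub_le (T x) (T x - c • V x)
    rw [norm_smul, hVx, hx, mul_one] at h4
    simp only [sub_apply, smul_apply] at h3
    linarith
  linarith

/-! ### Approximate orthogonality and the minimum modulus -/

/-- The quantitative Wielandt inequality: orthogonal vectors stay orthogonal up to
`(M² - m²) / (M² + m²)` under an operator with norm `M` and minimum modulus `m`. -/
theorem norm_inner_map_mul_le (T : H →L[ℂ] H) {x y : H} (hxy : inner ℂ x y = 0) :
    (‖T‖ ^ 2 + minModulus T ^ 2) * ‖inner ℂ (T x) (T y)‖ ≤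
      (‖T‖ ^ 2 - minModulus T ^ 2) * (‖T x‖ * ‖T y‖) := by
  set M := ‖T‖
  set m := minModulus T
  have hm : 0 ≤ m := minModulus_nonneg T
  have hM : 0 ≤ M := norm_nonneg T
  set a := ‖T x‖ with ha
  set b := ‖T y‖ with hb
  set c := ‖(inner ℂ (T x) (T y) : ℂ)‖ with hc
  have ha0 : 0 ≤ a := norm_nonneg _
  have hb0 : 0 ≤ b := norm_nonneg _
  rcases eq_or_ne (a * b) 0 with h0 | h0
  · have hcab : c ≤ a * b := norm_inner_le_norm _ _
    have : c = 0 := le_antisymm (h0 ▸ hcab) (norm_nonneg _)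
    rw [this, h0]; simp
  have hab : 0 < a * b := lt_of_le_of_ne (mul_nonneg ha0 hb0) h0.symm
  obtain ⟨θ, hθ, hθc⟩ : ∃ θ : ℂ, ‖θ‖ = 1 ∧ θ * inner ℂ (T x) (T y) = (c : ℂ) := by
    obtain ⟨θ, hθ, h⟩ := RCLike.exists_norm_eq_mul_self (inner ℂ (T x) (T y) : ℂ)
    exact ⟨θ, hθ, h.symm⟩
  -- This scaling gives `T p` and `T q` equal norms and a nonnegative inner product, while `p ⊥ q`
  -- still forces `‖p + q‖ = ‖p - q‖`.
  set p : H := (b : ℂ) • x with hp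
  set q : H := ((a : ℂ) * θ) • y with hq
  have hpq : (inner ℂ p q : ℂ) = 0 := by simp [hp, hq, hxy]
  have hTpq : (inner ℂ (T p) (T q) : ℂ) = ((a * b * c : ℝ) : ℂ) := by
    simp only [hp, hq, map_smul, inner_smul_left, inner_smul_right, Complex.conj_ofReal]
    push_cast
    rw [← hθc]; ring
  have hTp : ‖T p‖ = a * b := by simp [hp, norm_smul, abs_of_nonneg hb0, ← ha, mul_comm]
  have hTq : ‖T q‖ = a * b := by simp [hq, norm_smul, abs_of_nonneg ha0, hθ, ← hb]
  have hnorm : ‖p + q‖ = ‖p - q‖ := by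
    rw [← sq_eq_sq₀ (norm_nonneg _) (norm_nonneg _), @norm_add_sq ℂ, @norm_sub_sq ℂ, hpq]; simp
  have h1 : m * ‖T (p + q)‖ ≤ M * ‖T (p - q)‖ :=
    calc m * ‖T (p + q)‖ ≤ m * (M * ‖p - q‖) := by
          gcongr; rw [← hnorm]; exact T.le_opNorm _
      _ = M * (m * ‖p - q‖) := by ring
      _ ≤ M * ‖T (p - q)‖ := by gcongr; exact minModulus_mul_norm_le T _
  have h2 : m ^ 2 * ‖T (p + q)‖ ^ 2 ≤ M ^ 2 * ‖T (p - q)‖ ^ 2 := by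
    rw [← mul_pow, ← mul_pow]
    exact pow_le_pow_left₀ (by positivity) h1 2
  rw [map_add, map_sub, @norm_add_sq ℂ, @norm_sub_sq ℂ, hTpq, hTp, hTq] at h2
  simp only [RCLike.re_to_complex, Complex.ofReal_re] at h2
  have h3 : (a * b) * ((M ^ 2 + m ^ 2) * c) ≤ (a * b) * ((M ^ 2 - m ^ 2) * (a * b)) := by
    linarith
  exact le_of_mul_le_mul_left h3 hab

/-- An `ε`-approximately orthogonality preserving operator distorts norms at most by
`√((1 + ε) / (1 - ε))`. -/
theorem IsAOP.mul_sq_norm_le {ε : ℝ} (hε : 0 ≤ ε) {T : H →L[ℂ] H} (hT : IsAOP ε T) {x y : H}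
    (hxy : ‖x‖ = ‖y‖) : (1 - ε) * ‖T x‖ ^ 2 ≤ (1 + ε) * ‖T y‖ ^ 2 := by
  obtain ⟨θ, hθ, hθc⟩ := RCLike.exists_norm_eq_mul_self (inner ℂ x y : ℂ)
  -- Rotating `y` makes `⟨x, z⟩` real; with equal norms this gives `x + z ⊥ x - z`.
  set z : H := θ • y with hz
  have hzn : ‖z‖ = ‖x‖ := by simp [hz, norm_smul, hθ, hxy]
  have hTz : ‖T z‖ = ‖T y‖ := by simp [hz, norm_smul, hθ]
  have hxz : (inner ℂ x z : ℂ) = ((‖(inner ℂ x y : ℂ)‖ : ℝ) : ℂ) := by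
    rw [hz, inner_smul_right]; exact hθc.symm
  have hzx : (inner ℂ z x : ℂ) = inner ℂ x z := by
    rw [← inner_conj_symm, hxz, Complex.conj_ofReal]
  have horth : (inner ℂ (x + z) (x - z) : ℂ) = 0 := by
    rw [inner_add_left, inner_sub_right, inner_sub_right, hzx, inner_self_eq_norm_sq_to_K,
      inner_self_eq_norm_sq_to_K, hzn]
    ring
  have h1 := hT _ _ horth
  unfold EpsOrthogonal at h1
  have h2 : ‖T x‖ ^ 2 - ‖T z‖ ^ 2 ≤ ‖(inner ℂ (T (x + z)) (T (x - z)) : ℂ)‖ := by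
    refine le_trans (le_of_eq ?_) (Complex.re_le_norm _)
    rw [map_add, map_sub, inner_add_left, inner_sub_right, inner_sub_right,
      inner_self_eq_norm_sq_to_K, inner_self_eq_norm_sq_to_K, ← inner_conj_symm (T z) (T x)]
    simp only [Complex.add_re, Complex.sub_re, Complex.conj_re, Complex.coe_algebraMap]
    norm_cast
    ring
  have h3 := parallelogram_law_with_norm ℂ (T x) (T z)
  rw [← map_add, ← map_sub] at h3
  have h4 : ‖T (x + z)‖ * ‖T (x - z)‖ ≤ ‖T x‖ ^ 2 + ‖T z‖ ^ 2 := by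
    nlinarith [sq_nonneg (‖T (x + z)‖ - ‖T (x - z)‖)]
  rw [← hTz]
  nlinarith [mul_le_mul_of_nonneg_left h4 hε]

theorem epsHat_eq [Nontrivial H] {T : H →L[ℂ] H} (hT : T ≠ 0) :
    epsHat T = (‖T‖ ^ 2 - minModulus T ^ 2) / (‖T‖ ^ 2 + minModulus T ^ 2) := by
  have hM : 0 < ‖T‖ := norm_pos_iff.2 hT
  have hm := minModulus_nonneg T
  have hmM := minModulus_le_norm T
  have hpos : 0 < ‖T‖ ^ 2 + minModulus T ^ 2 := by positivity
  refine IsLeast.csInf_eq ⟨⟨⟨?_, ?_⟩, ?_⟩, ?_⟩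
  · exact div_nonneg (sub_nonneg.2 (pow_le_pow_left₀ hm hmM 2)) hpos.le
  · rw [div_le_one hpos]; nlinarith [sq_nonneg (minModulus T)]
  · intro x y hxy
    unfold EpsOrthogonal
    rw [mul_assoc, div_mul_eq_mul_div, le_div_iff₀ hpos, mul_comm]
    exact norm_inner_map_mul_le T hxy
  · rintro ε ⟨⟨h0, h1⟩, hε⟩
    have h1' : 0 ≤ 1 - ε := sub_nonneg.2 h1
    -- Taking square roots makes the distortion bound linear in the norms, so the supremum over `x`
    -- and the infimum over `y` can be taken separately.
    have hkey : √(1 - ε) * ‖T‖ ≤ √(1 + ε) * minModulus T := by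
      have hs : 0 < √(1 + ε) := Real.sqrt_pos.2 (by linarith)
      rw [← div_le_iff₀' hs]
      refine le_minModulus fun y hy => ?_
      rw [div_le_iff₀' hs]
      have hop : ‖((√(1 - ε) : ℝ) : ℂ) • T‖ ≤ √(1 + ε) * ‖T y‖ := by
        refine ContinuousLinearMap.opNorm_le_of_unit_norm (by positivity) fun x hx => ?_
        have h := hε.mul_sq_norm_le h0 (hx.trans hy.symm)
        rw [smul_apply, norm_smul, Complex.norm_real, Real.norm_eq_abs,
          abs_of_nonneg (Real.sqrt_nonneg _)]
        rw [← sq_le_sq₀ (by positivity) (by positivity)]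
        rwa [mul_pow, mul_pow, Real.sq_sqrt h1', Real.sq_sqrt (by linarith)]
      rwa [norm_smul, Complex.norm_real, Real.norm_eq_abs,
        abs_of_nonneg (Real.sqrt_nonneg _)] at hop
    have hsq := pow_le_pow_left₀ (by positivity) hkey 2
    rw [mul_pow, mul_pow, Real.sq_sqrt h1', Real.sq_sqrt (by linarith)] at hsq
    rw [div_le_iff₀ hpos]
    linarith

theorem half_norm_sub_minModulus_eq [Nontrivial H] (T : H →L[ℂ] H) :
    (‖T‖ - minModulus T) / 2 =
      (1 - √((1 - epsHat T) / (1 + epsHat T))) / 2 * ‖T‖ := by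
  have hm := minModulus_nonneg T
  have hmM := minModulus_le_norm T
  rcases eq_or_ne T 0 with rfl | hT
  · rw [norm_zero] at hmM
    simp [le_antisymm hmM hm]
  have hM : 0 < ‖T‖ := norm_pos_iff.2 hT
  have hpos : 0 < ‖T‖ ^ 2 + minModulus T ^ 2 := by positivity
  have : (1 - epsHat T) / (1 + epsHat T) = (minModulus T / ‖T‖) ^ 2 := by
    rw [epsHat_eq hT]
    have h2 : 1 + (‖T‖ ^ 2 - minModulus T ^ 2) / (‖T‖ ^ 2 + minModulus T ^ 2) =
        2 * ‖T‖ ^ 2 / (‖T‖ ^ 2 + minModulus T ^ 2) := by field_simp; ring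
    rw [h2]
    field_simp
    ring
  rw [this, Real.sqrt_sq (by positivity)]
  field_simp

/-! ### Polar decomposition and the distance -/

variable [CompleteSpace H]

open ContinuousLinearMap in
/-- If `A` is self-adjoint with `‖A x‖ = ‖T x‖` and the kernel of `T` is not larger than that of
its adjoint, then `T` factors through `A` by an isometry. -/
theorem exists_linearIsometry_comp_eq (T A : H →L[ℂ] H) (hA : IsSelfAdjoint A)
    (hTA : ∀ x, ‖A x‖ = ‖T x‖)
    (hker : hilbertDim (LinearMap.ker (T : H →ₗ[ℂ] H)) ≤
      hilbertDim (LinearMap.ker (adjoint T : H →ₗ[ℂ] H))) :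
    ∃ V : H →ₗᵢ[ℂ] H, ∀ x, V (A x) = T x := by
  have : CompleteSpace (LinearMap.ker (T : H →ₗ[ℂ] H)) := T.isClosed_ker.completeSpace_coe
  have : CompleteSpace (LinearMap.ker (adjoint T : H →ₗ[ℂ] H)) :=
    (adjoint T).isClosed_ker.completeSpace_coe
  obtain ⟨W⟩ := exists_linearIsometry_of_hilbertDim_le hker
  set N : Submodule ℂ H := LinearMap.ker (T : H →ₗ[ℂ] H) with hN
  have hNA : N = LinearMap.ker (A : H →ₗ[ℂ] H) := by
    ext x
    simp only [hN, LinearMap.mem_ker, coe_coe]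
    rw [← norm_eq_zero, ← hTA, norm_eq_zero]
  have hK : Nᗮ = (LinearMap.range (A : H →ₗ[ℂ] H)).topologicalClosure := by
    rw [hNA, orthogonal_ker, show adjoint A = A from hA]
  have hAK (x : H) : A x ∈ Nᗮ := by
    rw [hK]; exact Submodule.le_topologicalClosure _ ⟨x, rfl⟩
  let e : H →ₗ[ℂ] Nᗮ := (A : H →ₗ[ℂ] H).codRestrict Nᗮ hAK
  have he (x : H) : (e x : H) = A x := rfl
  have hdense : DenseRange e := by
    rw [DenseRange, Subtype.dense_iff]
    intro x hx
    have hx' : x ∈ (LinearMap.range (A : H →ₗ[ℂ] H)).topologicalClosure := hK ▸ hx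
    rw [← SetLike.mem_coe, Submodule.topologicalClosure_coe] at hx'
    refine closure_mono ?_ hx'
    rintro _ ⟨y, rfl⟩
    exact ⟨e y, ⟨y, rfl⟩, rfl⟩
  have hbound : ∀ x, ‖(T : H →ₗ[ℂ] H) x‖ ≤ 1 * ‖e x‖ := fun x => by
    rw [one_mul, Submodule.coe_norm, he, hTA, coe_coe]
  -- The map `A x ↦ T x` is isometric on the range of `A`, which is dense in `Nᗮ`, so it extends by
  -- continuity.
  let U : Nᗮ →L[ℂ] H := (T : H →ₗ[ℂ] H).extendOfNorm e
  have hU (x : H) : U (e x) = T x := LinearMap.extendOfNorm_eq hdense ⟨1, hbound⟩ x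
  have hUnorm (k : Nᗮ) : ‖U k‖ = ‖k‖ := by
    refine hdense.induction (P := fun k => ‖U k‖ = ‖k‖) ?_ ?_ k
    · rintro _ ⟨x, rfl⟩
      rw [hU, Submodule.coe_norm, he, hTA]
    · exact isClosed_eq (by fun_prop) (by fun_prop)
  have hUorth (k : Nᗮ) (w : LinearMap.ker (adjoint T : H →ₗ[ℂ] H)) :
      (inner ℂ (U k) (w : H) : ℂ) = 0 := by
    refine hdense.induction (P := fun k => (inner ℂ (U k) (w : H) : ℂ) = 0) ?_ ?_ k
    · rintro _ ⟨x, rfl⟩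
      rw [hU, ← adjoint_inner_right, show adjoint T (w : H) = 0 from w.2, inner_zero_right]
    · exact isClosed_eq (by fun_prop) (by fun_prop)
  -- `U` on `Nᗮ` and `W` on `N` have orthogonal ranges, so norms add by Pythagoras.
  let V : H →ₗ[ℂ] H := (U : Nᗮ →ₗ[ℂ] H) ∘ₗ (Nᗮ.orthogonalProjectionOnto : H →ₗ[ℂ] Nᗮ) +
    (LinearMap.ker (adjoint T : H →ₗ[ℂ] H)).subtype ∘ₗ W.toLinearMap ∘ₗ
      (N.orthogonalProjectionOnto : H →ₗ[ℂ] N)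
  have hV (x : H) : V x = U (Nᗮ.orthogonalProjectionOnto x) +
      (W (N.orthogonalProjectionOnto x) : H) := rfl
  refine ⟨⟨V, fun x => ?_⟩, fun x => ?_⟩
  · rw [← sq_eq_sq₀ (norm_nonneg _) (norm_nonneg _), hV, @norm_add_sq ℂ, hUorth, hUnorm,
      ← Submodule.coe_norm, W.norm_map, N.norm_sq_eq_add_norm_sq_projection x]
    simp
    ring
  · have h1 : N.orthogonalProjectionOnto (A x) = 0 :=
      Submodule.orthogonalProjectionOnto_eq_zero_iff.2 (hAK x)
    have h2 : Nᗮ.orthogonalProjectionOnto (A x) = e x :=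
      Submodule.orthogonalProjectionOnto_mem_subspace_eq_self (e x)
    change V (A x) = T x
    rw [hV, h1, h2, hU]
    simp

open ContinuousLinearMap in
/-- There is a self-adjoint operator (the modulus of `T`) with the same norms of images as `T`, whose
distance to the midpoint of `m(T)` and `‖T‖` is at most `(‖T‖ - m(T)) / 2`. -/
theorem exists_isSelfAdjoint_norm_apply_eq [Nontrivial H] (T : H →L[ℂ] H) :
    ∃ A : H →L[ℂ] H, IsSelfAdjoint A ∧ (∀ x, ‖A x‖ = ‖T x‖) ∧
      ‖A - (((‖T‖ + minModulus T) / 2 : ℝ) : ℂ) • (1 : H →L[ℂ] H)‖ ≤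
        (‖T‖ - minModulus T) / 2 := by
  have hm := minModulus_nonneg T
  have hmM := minModulus_le_norm T
  set B : H →L[ℂ] H := star T * T with hB
  have hBsa : IsSelfAdjoint B := IsSelfAdjoint.star_mul_self T
  have hinner (x : H) : (inner ℂ (B x) x : ℂ) = ((‖T x‖ ^ 2 : ℝ) : ℂ) := by
    rw [hB, show (star T * T) x = star T (T x) from rfl, star_eq_adjoint, adjoint_inner_left, inner_self_eq_norm_sq_to_K]
    norm_cast
  -- Equivalent to `B - m(T)²` being positive, i.e. `m(T)‖x‖ ≤ ‖T x‖`.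
  have hlow : ∀ t ∈ spectrum ℝ B, minModulus T ^ 2 ≤ t := by
    rw [← algebraMap_le_iff_le_spectrum hBsa, le_def, isPositive_def']
    refine ⟨hBsa.sub (.algebraMap _ (.all _)), fun x => ?_⟩
    have hx : algebraMap ℝ (H →L[ℂ] H) (minModulus T ^ 2) x =
        ((minModulus T ^ 2 : ℝ) : ℂ) • x := rfl
    rw [reApplyInnerSelf_apply, sub_apply, inner_sub_left, hinner, hx, inner_smul_left,
      Complex.conj_ofReal, inner_self_eq_norm_sq_to_K]
    simp only [RCLike.re_to_complex, Complex.coe_algebraMap]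
    norm_cast
    rw [sub_nonneg, ← mul_pow]
    exact pow_le_pow_left₀ (by positivity) (minModulus_mul_norm_le T x) 2
  have hup : ∀ t ∈ spectrum ℝ B, t ≤ ‖T‖ ^ 2 := by
    intro t ht
    refine (Real.le_norm_self t).trans ((spectrum.norm_le_norm_of_mem ht).trans ?_)
    rw [hB, CStarRing.norm_star_mul_self, sq]
  refine ⟨cfc Real.sqrt B, cfc_predicate _ _, fun x => ?_, ?_⟩
  · have hsq : cfc Real.sqrt B * cfc Real.sqrt B = B := by
      rw [← cfc_mul _ _ B]
      conv_rhs => rw [← cfc_id ℝ B]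
      exact cfc_congr fun t ht => Real.mul_self_sqrt ((sq_nonneg _).trans (hlow t ht))
    have hsa : adjoint (cfc Real.sqrt B) = cfc Real.sqrt B := cfc_predicate Real.sqrt B
    have hBx : B x = cfc Real.sqrt B (cfc Real.sqrt B x) := (DFunLike.congr_fun hsq x).symm
    rw [← sq_eq_sq₀ (norm_nonneg _) (norm_nonneg _), ← Complex.ofReal_inj, ← hinner, hBx,
      ← adjoint_inner_right, hsa, inner_self_eq_norm_sq_to_K]
    norm_cast
  · have : cfc Real.sqrt B - (((‖T‖ + minModulus T) / 2 : ℝ) : ℂ) • (1 : H →L[ℂ] H) =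
        cfc (fun t => √t - (‖T‖ + minModulus T) / 2) B := by
      rw [cfc_sub _ _ B, cfc_const _ B, Algebra.algebraMap_eq_smul_one]
      rfl
    rw [this]
    refine norm_cfc_le (by linarith) fun t ht => ?_
    have h1 : minModulus T ≤ √t := Real.le_sqrt_of_sq_le (hlow t ht)
    have h2 : √t ≤ ‖T‖ := Real.sqrt_le_iff.2 ⟨norm_nonneg _, hup t ht⟩
    rw [Real.norm_eq_abs, abs_le]
    constructor <;> linarith

theorem infDist_scalarIsometries_eq [Nontrivial H] (T : H →L[ℂ] H)
    (hker : hilbertDim (LinearMap.ker (T : H →ₗ[ℂ] H)) ≤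
      hilbertDim (LinearMap.ker (ContinuousLinearMap.adjoint T : H →ₗ[ℂ] H))) :
    Metric.infDist T (scalarIsometries H) = (‖T‖ - minModulus T) / 2 := by
  obtain ⟨A, hA, hTA, hnorm⟩ := exists_isSelfAdjoint_norm_apply_eq T
  obtain ⟨V, hV⟩ := exists_linearIsometry_comp_eq T A hA hTA hker
  set c : ℂ := (((‖T‖ + minModulus T) / 2 : ℝ) : ℂ)
  have hmem : c • V.toContinuousLinearMap ∈ scalarIsometries H :=
    ⟨c, V.toContinuousLinearMap, V.isometry, rfl⟩
  apply le_antisymm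
  · refine (Metric.infDist_le_dist_of_mem hmem).trans ?_
    rw [dist_eq_norm]
    -- Since `T = V A`, factoring out the isometry reduces the distance to that of `A` from a
    -- scalar.
    have heq : T - c • V.toContinuousLinearMap =
        V.toContinuousLinearMap.comp (A - c • (1 : H →L[ℂ] H)) := by
      ext x
      simp [hV]
    rw [heq]
    refine le_trans ?_ hnorm
    refine ContinuousLinearMap.opNorm_le_bound _ (norm_nonneg _) fun x => ?_
    rw [ContinuousLinearMap.comp_apply, LinearIsometry.coe_toContinuousLinearMap, V.norm_map]
    exact ContinuousLinearMap.le_opNorm _ x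
  · refine (Metric.le_infDist ⟨_, hmem⟩).2 ?_
    rintro _ ⟨d, W, hW, rfl⟩
    rw [dist_eq_norm]
    exact norm_sub_smul_isometry_ge T W hW d

end Operators

theorem theorem3p5 {H : Type*} [NormedAddCommGroup H] [InnerProductSpace ℂ H] [CompleteSpace H]
    (hdim : 2 ≤ Module.rank ℂ H) (T : H →L[ℂ] H)
    (hker : hilbertDim (LinearMap.ker (T : H →ₗ[ℂ] H)) ≤
      hilbertDim (LinearMap.ker (ContinuousLinearMap.adjoint T : H →ₗ[ℂ] H))) :
    Metric.infDist T (scalarIsometries H) = (‖T‖ - minModulus T) / 2 ∧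
      (‖T‖ - minModulus T) / 2 =
        (1 - Real.sqrt ((1 - epsHat T) / (1 + epsHat T))) / 2 * ‖T‖ := by
  have : Nontrivial H :=
    rank_pos_iff_nontrivial (R := ℂ).1 (lt_of_lt_of_le (by norm_num) hdim)
  exact ⟨infDist_scalarIsometries_eq T hker, half_norm_sub_minModulus_eq T⟩
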